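/- In the longest palindromic substring problem, the input is a string $A\in\{0,1\}^n$, and a substring is a block of consecutive characters. Let $d(A)$ be the maximum length of a substring of $A$ that reads the same forward and backward. For $c\in(0,1]$, a $c$-approximation is (the interval of positions of) a palindromic substring of $A$ of length at least $c\cdot d(A)$; in the version of the problem where only the length is wanted, it is a number $\ell$ with $c\cdot d(A)\le \ell\le d(A)$. A quantum algorithm for strings of length $n$ acts on an index register $i\in\{1,\dots,n\}$, an answer bit $a$ and an arbitrary finite-dimensional work register $z$. It starts in a fixed basis state, performs a fixed sequence of steps, each of which is either a call to the oracle $O_A\colon |i\rangle|a\rangle|z\rangle\mapsto|i\rangle|a\oplus A[i]\rangle|z\rangle$ or a unitary operator that does not depend on $A$, then measures in the computational basis and returns a function of the outcome. Its running time is the number of steps: an oracle call has unit cost, and so has every input-independent unitary operator (in particular every elementary gate). It solves a problem with high probability if, on every input $A\in\{0,1\}^n$, its result is correct with probability at least $9/10$. **Theorem.** For any constant $c\in(0,1]$, any quantum algorithm that computes with high probability a $c$-approximation of the longest palindromic substring of a binary string of length $n$ requires $\Omega(\sqrt n)$ time. That is, for every $c\in(0,1]$ there are $\kappa>0$ and $N$,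 depending only on $c$, such that for all $n\ge N$ every quantum algorithm for binary strings of length $n$ that outputs with high probability a $c$-approximate solution has running time at least $\kappa\sqrt n$. The same holds for every quantum algorithm that outputs with high probability only a $c$-approximation of the length. -/

import Mathlib

namespace QuantumLPS

/-! ### Strings and palindromic substrings -/

/-- `IsPalSubstring x w`: the word `w` is a substring (a block of consecutive characters) of the
binary string `x` of length `n` and reads the same forward and backward. -/
def IsPalSubstring {n : ℕ} (x : Fin n → Bool) (w : List Bool) : Prop :=
  w <:+: List.ofFn x ∧ w.Palindrome

/-- The length of a longest palindromic substring of `x`. -/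
noncomputable def lpsLength {n : ℕ} (x : Fin n → Bool) : ℕ :=
  sSup {d : ℕ | ∃ w : List Bool, IsPalSubstring x w ∧ w.length = d}

/-- The supremum defining `lpsLength` is attained. -/
theorem isGreatest_lpsLength {n : ℕ} (x : Fin n → Bool) :
    IsGreatest {d : ℕ | ∃ w : List Bool, IsPalSubstring x w ∧ w.length = d} (lpsLength x) := by
  have hb : BddAbove {d : ℕ | ∃ w : List Bool, IsPalSubstring x w ∧ w.length = d} := by
    refine ⟨n, ?_⟩
    rintro d ⟨w, hw, rfl⟩
    simpa using hw.1.length_le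
  refine ⟨Nat.sSup_mem ⟨0, [], ⟨List.nil_infix, List.Palindrome.nil⟩, rfl⟩ hb, ?_⟩
  intro d hd
  exact le_csSup hb hd

/-- The substring of `x` that occupies the positions `i, …, j - 1` (counted from `0`). -/
def substring {n : ℕ} (x : Fin n → Bool) (i j : ℕ) : List Bool :=
  ((List.ofFn x).drop i).take (j - i)

/-- The interval `[i, j)` of positions is a `c`-approximate solution of the longest palindromic
substring problem on `x`: the substring there is a palindrome, and its length `j - i` is at least
`c` times the length of a longest palindromic substring. -/
def IsApproxSolution {n : ℕ} (c : ℝ) (x : Fin n → Bool) (p : ℕ × ℕ) : Prop :=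
  p.1 ≤ p.2 ∧ p.2 ≤ n ∧ (substring x p.1 p.2).Palindrome ∧
    c * (lpsLength x : ℝ) ≤ ((p.2 - p.1 : ℕ) : ℝ)

/-- The number `l` is a `c`-approximation of the length `d` of a longest palindromic substring of
`x`, that is, `c * d ≤ l ≤ d`. -/
def IsApproxLength {n : ℕ} (c : ℝ) (x : Fin n → Bool) (l : ℝ) : Prop :=
  c * (lpsLength x : ℝ) ≤ l ∧ l ≤ (lpsLength x : ℝ)

/-! ### Quantum algorithms with oracle access to a binary string -/

/-- Classical configurations: an index register `i`, an answer bit `a` and a work register `z`. -/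
abbrev Config (n : ℕ) (W : Type) : Type := Fin n × Bool × W

/-- (Not necessarily normalized) state vectors, with one amplitude for each configuration. -/
abbrev State (n : ℕ) (W : Type) [Fintype W] : Type := EuclideanSpace ℂ (Config n W)

/-- The permutation `(i, a, z) ↦ (i, a ⊕ x i, z)` of the configurations. -/
def oraclePerm {n : ℕ} {W : Type} (x : Fin n → Bool) : Config n W ≃ Config n W where
  toFun s := (s.1, xor s.2.1 (x s.1), s.2.2)
  invFun s := (s.1, xor s.2.1 (x s.1), s.2.2)
  left_inv s := by simp
  right_inv s := by simp

/-- The oracle for `x`: the unitary operator with `|i⟩|a⟩|z⟩ ↦ |i⟩|a ⊕ x i⟩|z⟩`. -/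
noncomputable def oracle {n : ℕ} {W : Type} [Fintype W] (x : Fin n → Bool) :
    State n W ≃ₗᵢ[ℂ] State n W :=
  LinearIsometryEquiv.piLpCongrLeft 2 ℂ ℂ (oraclePerm x)

theorem oracle_single {n : ℕ} {W : Type} [Fintype W] [DecidableEq W] (x : Fin n → Bool)
    (i : Fin n) (a : Bool) (z : W) :
    oracle x (EuclideanSpace.single ((i, a, z) : Config n W) (1 : ℂ)) =
      EuclideanSpace.single ((i, xor a (x i), z) : Config n W) (1 : ℂ) := by
  unfold oracle
  rw [LinearIsometryEquiv.piLpCongrLeft_single]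
  rfl

/-- One step of a quantum algorithm: a call to the oracle, or a unitary operator that does not
depend on the input. -/
inductive Step (n : ℕ) (W : Type) [Fintype W] : Type
  | query : Step n W
  | gate (U : State n W ≃ₗᵢ[ℂ] State n W) : Step n W

/-- The unitary operator that a step performs when the input is `x`. -/
noncomputable def Step.op {n : ℕ} {W : Type} [Fintype W] (x : Fin n → Bool) :
    Step n W → (State n W ≃ₗᵢ[ℂ] State n W)
  | .query => oracle x
  | .gate U => U

/-- A quantum algorithm for binary input strings of length `n`, with work register `W` and results
in `R`: it starts in a fixed basis state, performs the steps of `steps` in order, measures all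
registers in the computational basis and returns a function of the measured configuration. -/
structure QuantumAlgorithm (n : ℕ) (W : Type) [Fintype W] (R : Type) : Type where
  init : Config n W
  steps : List (Step n W)
  result : Config n W → R

namespace QuantumAlgorithm

variable {n : ℕ} {W : Type} [Fintype W] {R : Type}

/-- The running time: the number of steps. An oracle call has cost one, and so has *every*
input-independent unitary operator, whatever its size (hence in particular each elementary gate
of any gate set). -/
def time (Q : QuantumAlgorithm n W R) : ℕ := Q.steps.length

open Classical in
/-- The state of the algorithm on input `x` just before the measurement. -/
noncomputable def finalState (Q : QuantumAlgorithm n W R) (x : Fin n → Bool) : State n W :=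
  Q.steps.foldl (fun ψ s => s.op x ψ) (EuclideanSpace.single Q.init 1)

open Classical in
/-- The probability (by the Born rule) that the result of the algorithm on input `x` satisfies
`P`. -/
noncomputable def prob (Q : QuantumAlgorithm n W R) (x : Fin n → Bool) (P : R → Prop) : ℝ :=
  ∑ s : Config n W, if P (Q.result s) then ‖Q.finalState x s‖ ^ 2 else 0

/-- The algorithm solves, with high probability (at least `9/10` on every input), the problem in
which `Sol x r` says that `r` is a correct result for the input `x`. -/
def SolvesWHP (Q : QuantumAlgorithm n W R) (Sol : (Fin n → Bool) → R → Prop) : Prop :=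
  ∀ x : Fin n → Bool, 9 / 10 ≤ Q.prob x (Sol x)

end QuantumAlgorithm

end QuantumLPS

/-!
Let `b = 001011001011…`, which has no palindromic substring longer than 4, and cut its positions
into blocks of a constant length `L > 4 / c`. Overwriting any one block by zeros raises the optimum
to at least `L`, so that no `c`-approximation for `b` is one for the modified string, and the
algorithm has to tell `b` from each of the `⌊n / L⌋` modified strings. By the hybrid argument of
Bennett, Bernstein, Brassard and Vazirani, the final states for two inputs that differ only inside
a block are at a distance of at most twice the sum, over the queries, of the norm of the part of
the queried state in that block. Disjoint blocks have orthogonal parts, so in `q` queries the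
squared norms add up to at most `q` over all blocks, and Cauchy–Schwarz gives `⌊n / L⌋ = O(q²)`.
-/

namespace QuantumLPS

open Finset

section Hybrid

variable {n : ℕ} {W : Type} [Fintype W]

/-- The orthogonal projection of the state `ψ` to the span of the configurations whose index
register lies in `S`; its squared norm is the weight with which `ψ` queries positions in `S`. -/
noncomputable def indexProj (S : Finset (Fin n)) (ψ : State n W) : State n W :=
  WithLp.toLp 2 fun s => if s.1 ∈ S then ψ s else 0

theorem norm_indexProj_sq (S : Finset (Fin n)) (ψ : State n W) :
    ‖indexProj S ψ‖ ^ 2 = ∑ s with s.1 ∈ S, ‖ψ s‖ ^ 2 := by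
  simp [EuclideanSpace.norm_sq_eq, indexProj, sum_filter, apply_ite]

theorem sum_norm_indexProj_sq_le {ι : Type*} {I : Finset ι} {S : ι → Finset (Fin n)}
    (hS : (I : Set ι).PairwiseDisjoint S) (ψ : State n W) :
    ∑ k ∈ I, ‖indexProj (S k) ψ‖ ^ 2 ≤ ‖ψ‖ ^ 2 := by
  classical
  have hdisj : (I : Set ι).PairwiseDisjoint fun k => ({s | s.1 ∈ S k} : Finset (Config n W)) :=
    fun k hk l hl hkl => disjoint_filter.2 fun _ _ hs => Finset.disjoint_left.1 (hS hk hl hkl) hs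
  simp_rw [norm_indexProj_sq, EuclideanSpace.norm_sq_eq]
  rw [← sum_biUnion hdisj]
  exact sum_le_univ_sum_of_nonneg fun _ => sq_nonneg _

theorem oracle_apply (x : Fin n → Bool) (ψ : State n W) (s : Config n W) :
    oracle x ψ s = ψ (oraclePerm x s) := rfl

theorem oracle_sub_oracle_indexProj {S : Finset (Fin n)} {x y : Fin n → Bool}
    (h : ∀ i ∉ S, x i = y i) (ψ : State n W) :
    oracle x (indexProj S ψ) - oracle y (indexProj S ψ) = oracle x ψ - oracle y ψ := by
  ext s
  by_cases hs : s.1 ∈ S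
  · simp [oracle_apply, indexProj, oraclePerm, hs]
  · simp [oracle_apply, oraclePerm, h s.1 hs]

theorem norm_oracle_sub_oracle_le {S : Finset (Fin n)} {x y : Fin n → Bool}
    (h : ∀ i ∉ S, x i = y i) (ψ : State n W) :
    ‖oracle x ψ - oracle y ψ‖ ≤ 2 * ‖indexProj S ψ‖ := by
  rw [← oracle_sub_oracle_indexProj h]
  refine (norm_sub_le _ _).trans_eq ?_
  rw [LinearIsometryEquiv.norm_map, LinearIsometryEquiv.norm_map, two_mul]

namespace QuantumAlgorithm

variable {R : Type}

open Classical in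
/-- The state of the algorithm on input `x` after its first `t` steps (after all of its steps if
`t` exceeds the running time). -/
noncomputable def stateAt (Q : QuantumAlgorithm n W R) (x : Fin n → Bool) (t : ℕ) : State n W :=
  (Q.steps.take t).foldl (fun ψ s => s.op x ψ) (EuclideanSpace.single Q.init 1)

open Classical in
/-- The times, counted from `0`, at which the algorithm calls the oracle. -/
noncomputable def queryTimes (Q : QuantumAlgorithm n W R) : Finset ℕ :=
  {t ∈ range Q.time | Q.steps[t]? = some .query}

/-- The query complexity: the number of oracle calls. -/
noncomputable def queryCount (Q : QuantumAlgorithm n W R) : ℕ := #Q.queryTimes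

open Classical in
theorem queryCount_le_time (Q : QuantumAlgorithm n W R) : Q.queryCount ≤ Q.time :=
  (card_filter_le _ _).trans_eq (card_range _)

theorem stateAt_time (Q : QuantumAlgorithm n W R) (x : Fin n → Bool) :
    Q.stateAt x Q.time = Q.finalState x := by
  simp [stateAt, finalState, time]

theorem stateAt_succ (Q : QuantumAlgorithm n W R) (x : Fin n → Bool) (t : ℕ) :
    Q.stateAt x (t + 1) = Q.steps[t]?.elim (Q.stateAt x t) fun s => s.op x (Q.stateAt x t) := by
  rw [stateAt, List.take_add_one, List.foldl_append]
  cases Q.steps[t]? <;> rfl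

theorem norm_stateAt (Q : QuantumAlgorithm n W R) (x : Fin n → Bool) (t : ℕ) :
    ‖Q.stateAt x t‖ = 1 := by
  induction t with
  | zero => simp [stateAt]
  | succ t ih => rw [stateAt_succ]; cases Q.steps[t]? <;> simp [ih]

theorem norm_finalState (Q : QuantumAlgorithm n W R) (x : Fin n → Bool) :
    ‖Q.finalState x‖ = 1 := by
  rw [← stateAt_time, norm_stateAt]

open Classical in
theorem norm_stateAt_sub_le (Q : QuantumAlgorithm n W R) {S : Finset (Fin n)}
    {x y : Fin n → Bool} (h : ∀ i ∉ S, x i = y i) (t : ℕ) :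
    ‖Q.stateAt x t - Q.stateAt y t‖ ≤
      ∑ u ∈ range t with Q.steps[u]? = some .query, 2 * ‖indexProj S (Q.stateAt x u)‖ := by
  induction t with
  | zero => simp [stateAt]
  | succ t ih =>
    rw [sum_filter, sum_range_succ, ← sum_filter, stateAt_succ, stateAt_succ]
    rcases Q.steps[t]? with _ | _ | U
    · simpa using ih
    · calc ‖oracle x (Q.stateAt x t) - oracle y (Q.stateAt y t)‖
        _ ≤ ‖oracle x (Q.stateAt x t) - oracle y (Q.stateAt x t)‖ +
            ‖oracle y (Q.stateAt x t) - oracle y (Q.stateAt y t)‖ :=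
          norm_sub_le_norm_sub_add_norm_sub _ _ _
        _ = ‖Q.stateAt x t - Q.stateAt y t‖ +
            ‖oracle x (Q.stateAt x t) - oracle y (Q.stateAt x t)‖ := by
          rw [← map_sub, LinearIsometryEquiv.norm_map, add_comm]
        _ ≤ _ := by
          rw [if_pos rfl]
          exact add_le_add ih (norm_oracle_sub_oracle_le h _)
    · simpa [Step.op, ← map_sub] using ih

theorem norm_finalState_sub_sq_le (Q : QuantumAlgorithm n W R) {S : Finset (Fin n)}
    {x y : Fin n → Bool} (h : ∀ i ∉ S, x i = y i) :
    ‖Q.finalState x - Q.finalState y‖ ^ 2 ≤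
      4 * Q.queryCount * ∑ u ∈ Q.queryTimes, ‖indexProj S (Q.stateAt x u)‖ ^ 2 := by
  have hdist : ‖Q.finalState x - Q.finalState y‖ ≤
      ∑ u ∈ Q.queryTimes, 2 * ‖indexProj S (Q.stateAt x u)‖ := by
    rw [← stateAt_time, ← stateAt_time]
    exact Q.norm_stateAt_sub_le h Q.time
  calc ‖Q.finalState x - Q.finalState y‖ ^ 2
    _ ≤ (∑ u ∈ Q.queryTimes, 2 * ‖indexProj S (Q.stateAt x u)‖) ^ 2 := by gcongr
    _ ≤ Q.queryCount * ∑ u ∈ Q.queryTimes, (2 * ‖indexProj S (Q.stateAt x u)‖) ^ 2 :=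
      sq_sum_le_card_mul_sum_sq
    _ = 4 * Q.queryCount * ∑ u ∈ Q.queryTimes, ‖indexProj S (Q.stateAt x u)‖ ^ 2 := by
      simp_rw [mul_pow, ← mul_sum]
      ring

theorem prob_add_prob_le_one (Q : QuantumAlgorithm n W R) (x : Fin n → Bool) {P P' : R → Prop}
    (h : ∀ r, P r → ¬ P' r) : Q.prob x P + Q.prob x P' ≤ 1 := by
  have hnorm : ∑ s, ‖Q.finalState x s‖ ^ 2 = 1 := by
    rw [← EuclideanSpace.norm_sq_eq, norm_finalState, one_pow]
  rw [← hnorm, prob, prob, ← sum_add_distrib]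
  refine sum_le_sum fun s _ => ?_
  have := h (Q.result s)
  split_ifs <;> simp_all

theorem prob_le_two_mul_prob_add (Q : QuantumAlgorithm n W R) (x y : Fin n → Bool)
    (P : R → Prop) :
    Q.prob x P ≤ 2 * Q.prob y P + 2 * ‖Q.finalState x - Q.finalState y‖ ^ 2 := by
  rw [EuclideanSpace.norm_sq_eq, prob, prob, mul_sum, mul_sum, ← sum_add_distrib]
  refine sum_le_sum fun s _ => ?_
  rw [PiLp.sub_apply]
  split_ifs
  · calc ‖Q.finalState x s‖ ^ 2
      _ ≤ (‖Q.finalState y s‖ + ‖Q.finalState x s - Q.finalState y s‖) ^ 2 := by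
        gcongr
        exact norm_le_insert' _ _
      _ ≤ 2 * ‖Q.finalState y s‖ ^ 2 + 2 * ‖Q.finalState x s - Q.finalState y s‖ ^ 2 := by
        rw [← mul_add]
        exact add_sq_le
  · positivity

theorem SolvesWHP.le_norm_finalState_sub_sq {Q : QuantumAlgorithm n W R}
    {Sol : (Fin n → Bool) → R → Prop} (hQ : Q.SolvesWHP Sol) {x y : Fin n → Bool}
    (h : ∀ r, Sol x r → ¬ Sol y r) :
    1 / 3 ≤ ‖Q.finalState x - Q.finalState y‖ ^ 2 := by
  linarith [hQ x, hQ y, Q.prob_add_prob_le_one y h, Q.prob_le_two_mul_prob_add x y (Sol x)]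

theorem SolvesWHP.card_le_queryCount_sq {Q : QuantumAlgorithm n W R}
    {Sol : (Fin n → Bool) → R → Prop} (hQ : Q.SolvesWHP Sol) {ι : Type*} {I : Finset ι}
    {S : ι → Finset (Fin n)} (hS : (I : Set ι).PairwiseDisjoint S) {x : Fin n → Bool}
    {y : ι → Fin n → Bool} (hxy : ∀ k ∈ I, ∀ i ∉ S k, x i = y k i)
    (hSol : ∀ k ∈ I, ∀ r, Sol x r → ¬ Sol (y k) r) :
    (#I : ℝ) ≤ 12 * (Q.queryCount : ℝ) ^ 2 := by
  have hblock : ∀ k ∈ I, 1 / 3 ≤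
      4 * Q.queryCount * ∑ u ∈ Q.queryTimes, ‖indexProj (S k) (Q.stateAt x u)‖ ^ 2 :=
    fun k hk => (hQ.le_norm_finalState_sub_sq (hSol k hk)).trans
      (Q.norm_finalState_sub_sq_le (hxy k hk))
  have hweight : ∑ u ∈ Q.queryTimes, ∑ k ∈ I, ‖indexProj (S k) (Q.stateAt x u)‖ ^ 2 ≤
      Q.queryCount :=
    calc ∑ u ∈ Q.queryTimes, ∑ k ∈ I, ‖indexProj (S k) (Q.stateAt x u)‖ ^ 2
      _ ≤ ∑ u ∈ Q.queryTimes, ‖Q.stateAt x u‖ ^ 2 :=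
        sum_le_sum fun u _ => sum_norm_indexProj_sq_le hS _
      _ = Q.queryCount := by simp [norm_stateAt, queryCount]
  have hsum : (#I : ℝ) * (1 / 3) ≤ 4 * Q.queryCount * Q.queryCount :=
    calc (#I : ℝ) * (1 / 3)
      _ = ∑ k ∈ I, (1 / 3 : ℝ) := by rw [sum_const, nsmul_eq_mul]
      _ ≤ ∑ k ∈ I,
          4 * Q.queryCount * ∑ u ∈ Q.queryTimes, ‖indexProj (S k) (Q.stateAt x u)‖ ^ 2 :=
        sum_le_sum hblock
      _ = 4 * Q.queryCount *
          ∑ u ∈ Q.queryTimes, ∑ k ∈ I, ‖indexProj (S k) (Q.stateAt x u)‖ ^ 2 := by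
        rw [← mul_sum, sum_comm]
      _ ≤ 4 * Q.queryCount * Q.queryCount := by gcongr
  linarith

end QuantumAlgorithm

end Hybrid

section Palindromes

variable {n : ℕ}

theorem sub_le_lpsLength {x : Fin n → Bool} {i j : ℕ} (hj : j ≤ n)
    (h : (substring x i j).Palindrome) : j - i ≤ lpsLength x := by
  refine (isGreatest_lpsLength x).2 ⟨substring x i j, ⟨?_, h⟩, ?_⟩
  · exact (List.take_prefix _ _).isInfix.trans (List.drop_suffix _ _).isInfix
  · rw [substring, List.length_take, List.length_drop, List.length_ofFn]
    omega

theorem sub_le_lpsLength_of_forall_eq {x : Fin n → Bool} {i j : ℕ} (hj : j ≤ n) {b : Bool}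
    (h : ∀ k : Fin n, i ≤ k → k < j → x k = b) : j - i ≤ lpsLength x := by
  refine sub_le_lpsLength hj ?_
  have hconst : substring x i j = List.replicate (j - i) b := by
    refine List.ext_getElem (by simp [substring]; omega) fun k hk _ => ?_
    simp only [substring, List.length_take, List.length_drop, List.length_ofFn] at hk
    simpa [substring] using h ⟨i + k, by omega⟩ (Nat.le_add_right i k) (by dsimp only; omega)
  exact .of_reverse_eq (by rw [hconst, List.reverse_replicate])

theorem IsPalSubstring.exists_forall_eq {f : ℕ → Bool} {w : List Bool}
    (h : IsPalSubstring (fun i : Fin n => f i) w) :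
    ∃ a, ∀ j k, j + k + 1 = w.length → f (a + j) = f (a + k) := by
  obtain ⟨a, hlen, hget⟩ := List.infix_iff_getElem?.1 h.1
  rw [List.length_ofFn] at hlen
  have hw : ∀ j (hj : j < w.length), w[j] = f (a + j) := fun j hj => by
    have hj' := hget j hj
    rw [List.getElem?_eq_getElem (by simp; omega)] at hj'
    simpa [add_comm] using hj'.symm
  refine ⟨a, fun j k hjk => ?_⟩
  have hrev : w.reverse[j]'(by simp; omega) = w[j] := by simp only [h.2.reverse_eq]
  rw [← hw j (by omega), ← hw k (by omega), ← hrev, List.getElem_reverse]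
  congr 1
  omega

/-- The characters of the periodic word `001011001011…`, the infinite binary word whose prefixes
serve as strings with only short palindromic substrings. -/
def periodicBit (i : ℕ) : Bool := i % 6 = 2 ∨ i % 6 = 4 ∨ i % 6 = 5

theorem not_palindrome_five_periodicBit (a : ℕ) :
    ¬ (periodicBit a = periodicBit (a + 4) ∧ periodicBit (a + 1) = periodicBit (a + 3)) := by
  have : a % 6 < 6 := Nat.mod_lt _ (by norm_num)
  simp only [periodicBit, Nat.add_mod a]
  interval_cases a % 6 <;> decide

theorem not_palindrome_six_periodicBit (a : ℕ) :
    ¬ (periodicBit a = periodicBit (a + 5) ∧ periodicBit (a + 1) = periodicBit (a + 4) ∧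
      periodicBit (a + 2) = periodicBit (a + 3)) := by
  have : a % 6 < 6 := Nat.mod_lt _ (by norm_num)
  simp only [periodicBit, Nat.add_mod a]
  interval_cases a % 6 <;> decide

theorem lpsLength_periodicBit_le (n : ℕ) : lpsLength (fun i : Fin n => periodicBit i) ≤ 4 := by
  obtain ⟨w, hw, hlen⟩ := (isGreatest_lpsLength fun i : Fin n => periodicBit i).1
  obtain ⟨a, hsymm⟩ := hw.exists_forall_eq
  by_contra! hlt
  -- A palindrome of length at least 5 contains one of length 5 or 6 with the same centre.
  obtain ⟨d, hd | hd⟩ : ∃ d, w.length = 2 * d + 5 ∨ w.length = 2 * d + 6 :=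
    ⟨(w.length - 5) / 2, by omega⟩
  · exact not_palindrome_five_periodicBit (a + d)
      ⟨hsymm d (d + 4) (by omega), hsymm (d + 1) (d + 3) (by omega)⟩
  · exact not_palindrome_six_periodicBit (a + d)
      ⟨hsymm d (d + 5) (by omega), hsymm (d + 1) (d + 4) (by omega),
        hsymm (d + 2) (d + 3) (by omega)⟩

/-- The `k`-th of the consecutive blocks of `L` positions into which a string is divided. -/
def block (n L k : ℕ) : Finset (Fin n) := {i | (i : ℕ) / L = k}

theorem le_lpsLength_piecewise_block {L k : ℕ} (hk : k < n / L) (b : Bool) (x : Fin n → Bool) :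
    L ≤ lpsLength ((block n L k).piecewise (fun _ => b) x) := by
  have hend : (k + 1) * L ≤ n := (Nat.mul_le_mul_right L hk).trans (Nat.div_mul_le_self n L)
  calc L = (k + 1) * L - k * L := by rw [add_one_mul, Nat.add_sub_cancel_left]
    _ ≤ _ := sub_le_lpsLength_of_forall_eq hend fun i hi hi' =>
      piecewise_eq_of_mem _ _ _ (mem_filter.2 ⟨mem_univ i, Nat.div_eq_of_lt_le hi hi'⟩)

end Palindromes

section Approximation

variable {n : ℕ} {R : Type} {c : ℝ}

/-- In the problem `Sol`, two strings whose longest palindromic substrings differ in length by a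
factor of more than `1 / c` have no common correct result. This is all that the lower bound needs
to know about a problem, and it holds for both versions of `c`-approximation. -/
def SeparatesLengths (c : ℝ) (Sol : (Fin n → Bool) → R → Prop) : Prop :=
  ∀ x y : Fin n → Bool, (lpsLength x : ℝ) < c * lpsLength y → ∀ r, Sol x r → ¬ Sol y r

theorem separatesLengths_isApproxLength :
    SeparatesLengths c (IsApproxLength c : (Fin n → Bool) → ℝ → Prop) :=
  fun _ _ hxy _ hx hy => (hx.2.trans_lt hxy).not_ge hy.1

theorem separatesLengths_isApproxSolution :
    SeparatesLengths c (IsApproxSolution c : (Fin n → Bool) → ℕ × ℕ → Prop) := by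
  rintro x y hxy ⟨i, j⟩ ⟨-, hj, hpal, -⟩ ⟨-, -, -, hy⟩
  have hx : ((j - i : ℕ) : ℝ) ≤ lpsLength x := by exact_mod_cast sub_le_lpsLength hj hpal
  exact (hx.trans_lt hxy).not_ge hy

theorem SeparatesLengths.div_le_queryCount_sq {Sol : (Fin n → Bool) → R → Prop}
    (hSol : SeparatesLengths c Sol) (hc : 0 < c) {L : ℕ} (hL : 4 < c * L) {W : Type} [Fintype W]
    {Q : QuantumAlgorithm n W R} (hQ : Q.SolvesWHP Sol) :
    ((n / L : ℕ) : ℝ) ≤ 12 * (Q.queryCount : ℝ) ^ 2 := by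
  have hgap : ∀ k ∈ range (n / L), (lpsLength (fun i : Fin n => periodicBit i) : ℝ) <
      c * lpsLength ((block n L k).piecewise (fun _ => false) fun i => periodicBit i) :=
    fun k hk => calc
      (lpsLength (fun i : Fin n => periodicBit i) : ℝ)
      _ ≤ 4 := by exact_mod_cast lpsLength_periodicBit_le n
      _ < c * L := hL
      _ ≤ _ := by gcongr; exact le_lpsLength_piecewise_block (mem_range.1 hk) _ _
  simpa only [card_range] using
    hQ.card_le_queryCount_sq (Set.pairwiseDisjoint_filter _ _ _)
      (fun k _ i hi => (piecewise_eq_of_notMem (block n L k) _ _ hi).symm)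
      fun k hk => hSol _ _ (hgap k hk)

end Approximation

end QuantumLPS

theorem theorem9_general (c : ℝ) (hc : 0 < c) :
    ∃ κ : ℝ, 0 < κ ∧ ∃ N : ℕ, ∀ n : ℕ, N ≤ n → ∀ (W : Type) [Fintype W] (R : Type)
      (Sol : (Fin n → Bool) → R → Prop), QuantumLPS.SeparatesLengths c Sol →
      ∀ Q : QuantumLPS.QuantumAlgorithm n W R, Q.SolvesWHP Sol →
        κ * Real.sqrt n ≤ (Q.queryCount : ℝ) := by
  obtain ⟨L, hL⟩ := exists_nat_gt (4 / c)
  have hL0 : (0 : ℝ) < L := (div_pos four_pos hc).trans hL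
  refine ⟨(√(24 * L))⁻¹, by positivity, L, fun n hn W _ R Sol hSol Q hQ => ?_⟩
  have hblocks := hSol.div_le_queryCount_sq hc ((div_lt_iff₀' hc).1 hL) hQ
  have hfloor : (n : ℝ) ≤ 2 * L * (n / L : ℕ) := by
    have hpos : 0 < L := by exact_mod_cast hL0
    have hone : 1 ≤ n / L := (Nat.one_le_div_iff hpos).2 hn
    have hdiv : n < L * (n / L + 1) := Nat.lt_mul_div_succ n hpos
    exact_mod_cast (show n ≤ 2 * L * (n / L) by nlinarith)
  rw [inv_mul_le_iff₀ (by positivity), Real.sqrt_le_iff, mul_pow, Real.sq_sqrt (by positivity)]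
  refine ⟨by positivity, ?_⟩
  calc (n : ℝ) ≤ 2 * L * (n / L : ℕ) := hfloor
    _ ≤ 2 * L * (12 * (Q.queryCount : ℝ) ^ 2) := by gcongr
    _ = 24 * L * (Q.queryCount : ℝ) ^ 2 := by ring

theorem theorem9 (c : ℝ) (hc0 : 0 < c) (hc1 : c ≤ 1) :
    ∃ κ : ℝ, 0 < κ ∧ ∃ N : ℕ, ∀ n : ℕ, N ≤ n → ∀ (W : Type) [Fintype W],
      (∀ Q : QuantumLPS.QuantumAlgorithm n W (ℕ × ℕ),
        Q.SolvesWHP (QuantumLPS.IsApproxSolution c) → κ * Real.sqrt n ≤ (Q.time : ℝ)) ∧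
      (∀ Q : QuantumLPS.QuantumAlgorithm n W ℝ,
        Q.SolvesWHP (QuantumLPS.IsApproxLength c) → κ * Real.sqrt n ≤ (Q.time : ℝ)) := by
  obtain ⟨κ, hκ, N, hN⟩ := theorem9_general c hc0
  have hcount {n} {W : Type} [Fintype W] {R} (Q : QuantumLPS.QuantumAlgorithm n W R) :
      (Q.queryCount : ℝ) ≤ Q.time := Nat.cast_le.2 Q.queryCount_le_time
  exact ⟨κ, hκ, N, fun n hn W _ =>
    ⟨fun Q hQ => (hN n hn W _ _ QuantumLPS.separatesLengths_isApproxSolution Q hQ).trans (hcount Q),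
    fun Q hQ => (hN n hn W _ _ QuantumLPS.separatesLengths_isApproxLength Q hQ).trans (hcount Q)⟩⟩
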